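/- Let $\mathcal S,\mathcal A$ be finite and let $\mathcal M=(\mathcal S,\mathcal A,P,r,\gamma)$ be a Markov decision process with $\gamma\in(0,1)$ and $|r(s,a)|\le R_{\max}$ for all $(s,a)$ (in particular, $r(s,a)\in[0,R_{\max}]$ is allowed). The optimal action-value function $Q^*$ of $\mathcal M$ is the unique fixed point of the Bellman operator $(TQ)(s,a)=r(s,a)+\gamma\sum_{s'}P(s'\mid s,a)\max_{a'}Q(s',a')$. Fix a choice model with parameter $\theta\in\mathbb R^d$: a finite nonempty set $\mathcal J$ of booking choices with multinomial logit probabilities $P(j\mid s,a;\theta)=e^{\theta^\top\phi_j(s,a)}/\sum_k e^{\theta^\top\phi_k(s,a)}$; a finite set of orders $o$, each with a distribution $P(z\mid o;\theta)$ on a finite set of shock outcomes; finite sets $\mathcal N(s,a,j)$ of orders whose shocks are imputed; rewards $r^{\mathrm{imm}}(s,a,j)$ and $r^{\mathrm{shock}}(o,z)$; and a next-state map $f(s,a,j,\{z_o\})$. A synthetic sample at $(s,a)$ is obtained by drawing $j'\sim P(\cdot\mid s,a;\theta)$ and, independently, $z_o\sim P(\cdot\mid o;\theta)$ for all orders, and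 setting $r'=r^{\mathrm{imm}}(s,a,j')+\sum_{o\in\mathcal N(s,a,j')}r^{\mathrm{shock}}(o,z_o)$ and $s'=f(s,a,j',\{z_o\})$. The induced approximate MDP $\tilde{\mathcal M}_\theta$ has reward $\tilde r_\theta(s,a)=\mathbb E[r']$, transition kernel $\tilde P_\theta(\cdot\mid s,a)=\mathrm{Law}(s')$ and discount factor $\gamma$; let $\tilde Q^*$ be its optimal action-value function. Put $\varepsilon_r=\|\tilde r_\theta-r\|_\infty$ and $\varepsilon_P=\max_{s,a}\|\tilde P_\theta(\cdot\mid s,a)-P(\cdot\mid s,a)\|_1$. Let $Q_0$ be an arbitrary deterministic table, and run tabular Q-learning with samples from $\tilde{\mathcal M}_\theta$ on a probability space with filtration $(\mathcal F_t)_{t\ge0}$: at time $t$ the pair $(s_t,a_t)$ and the step size $\alpha_t\in[0,1]$ are $\mathcal F_t$-measurable; conditionally on $\mathcal F_t$ a synthetic sample $(r'_t,s'_{t+1})$ is drawn at $(s_t,a_t)$, the draw being $\mathcal F_{t+1}$-measurable; and $$Q_{t+1}(s_t,a_t)=(1-\alpha_t)Q_t(s_t,a_t)+\alpha_t\bigl[r'_t+\gamma\max_{a'}Q_t(s'_{t+1},a')\bigr],$$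 all other entries being unchanged. (The rule that generates $(s_t,a_t)$ from the history is arbitrary; $\varepsilon$-greedy exploration is one example.) Assume coverage: almost surely, for every $(s,a)$, the step sizes along the visits to $(s,a)$ satisfy $\sum_{t:(s_t,a_t)=(s,a)}\alpha_t=\infty$ and $\sum_{t:(s_t,a_t)=(s,a)}\alpha_t^2<\infty$. (For $\alpha_t=1/n_t(s_t,a_t)$, with $n_t$ the visit count up to and including time $t$, this says that every pair is visited infinitely often.) Then, almost surely, the sampling noise vanishes, $\lim_{t\to\infty}\|Q_t-\tilde Q^*\|_\infty=0$, the error tends to the bias of the partial model, $\lim_{t\to\infty}\|Q_t-Q^*\|_\infty=\|\tilde Q^*-Q^*\|_\infty$, and $$\limsup_{t\to\infty}\|Q_t-Q^*\|_\infty\;\le\;\frac{\varepsilon_r}{1-\gamma}+\frac{\gamma R_{\max}\,\varepsilon_P}{(1-\gamma)^2}.$$ -/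

import Mathlib

open MeasureTheory Filter Topology

noncomputable section

/-- A finite discounted Markov decision process: expected one-step reward `r(s,a)`,
transition kernel `P(s' | s,a)` and discount factor `γ ∈ (0,1)`. -/
structure MDP (S A : Type*) [Fintype S] where
  reward : S × A → ℝ
  trans : S × A → S → ℝ
  trans_mem : ∀ x, trans x ∈ stdSimplex ℝ S
  discount : ℝ
  discount_mem : discount ∈ Set.Ioo (0 : ℝ) 1

/-- `max_{a'} Q(s,a')`. -/
def maxQ {S A : Type*} [Fintype A] [Nonempty A] (Q : S × A → ℝ) (s : S) : ℝ :=
  Finset.univ.sup' Finset.univ_nonempty fun a => Q (s, a)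

theorem abs_maxQ_sub_le {S A : Type*} [Fintype S] [Fintype A] [Nonempty A]
    (Q Q' : S × A → ℝ) (s : S) : |maxQ Q s - maxQ Q' s| ≤ dist Q Q' := by
  have key : ∀ R R' : S × A → ℝ, maxQ R s - maxQ R' s ≤ dist R R' := by
    intro R R'
    rw [sub_le_iff_le_add]
    refine Finset.sup'_le _ _ fun a _ => ?_
    have h1 : R (s, a) - R' (s, a) ≤ dist R R' :=
      (le_abs_self _).trans (dist_le_pi_dist R R' (s, a))
    have h2 : R' (s, a) ≤ maxQ R' s :=
      Finset.le_sup' (fun a => R' (s, a)) (Finset.mem_univ a)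
    linarith
  rw [abs_le]
  have h1 := key Q Q'
  have h2 := key Q' Q
  rw [dist_comm] at h2
  constructor <;> linarith

namespace MDP

variable {S A : Type*} [Fintype S] [Fintype A] [Nonempty A]

/-- The Bellman optimality operator
`(TQ)(s,a) = r(s,a) + γ ∑_{s'} P(s' | s,a) max_{a'} Q(s',a')`. -/
def bellman (M : MDP S A) (Q : S × A → ℝ) : S × A → ℝ :=
  fun x => M.reward x + M.discount * ∑ s', M.trans x s' * maxQ Q s'

theorem contracting_bellman (M : MDP S A) :
    ContractingWith ⟨M.discount, M.discount_mem.1.le⟩ M.bellman := by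
  refine ⟨M.discount_mem.2, LipschitzWith.of_dist_le_mul fun Q Q' => ?_⟩
  have h0 : 0 ≤ M.discount := M.discount_mem.1.le
  refine (dist_pi_le_iff (mul_nonneg h0 dist_nonneg)).2 fun x => ?_
  have h1 : M.bellman Q x - M.bellman Q' x =
      M.discount * ∑ s', M.trans x s' * (maxQ Q s' - maxQ Q' s') := by
    simp only [bellman, mul_sub, Finset.sum_sub_distrib]
    ring
  have h2 : |∑ s', M.trans x s' * (maxQ Q s' - maxQ Q' s')| ≤ dist Q Q' := by
    calc |∑ s', M.trans x s' * (maxQ Q s' - maxQ Q' s')|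
        ≤ ∑ s', |M.trans x s' * (maxQ Q s' - maxQ Q' s')| := Finset.abs_sum_le_sum_abs _ _
      _ ≤ ∑ s', M.trans x s' * dist Q Q' := by
          refine Finset.sum_le_sum fun s' _ => ?_
          rw [abs_mul, abs_of_nonneg ((M.trans_mem x).1 s')]
          exact mul_le_mul_of_nonneg_left (abs_maxQ_sub_le Q Q' s') ((M.trans_mem x).1 s')
      _ = dist Q Q' := by rw [← Finset.sum_mul, (M.trans_mem x).2, one_mul]
  rw [Real.dist_eq, h1, abs_mul, abs_of_nonneg h0]
  exact mul_le_mul_of_nonneg_left h2 h0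

/-- The optimal action-value function: the unique fixed point of the Bellman optimality
operator. -/
def qStar (M : MDP S A) : S × A → ℝ :=
  M.contracting_bellman.fixedPoint M.bellman

end MDP

/-- A discrete choice model for customer behaviour on the reduced state space.
`J` is the set of booking choices (room types and the outside option), `O` the orders,
`Z` the possible shock outcomes of an order (keep, modify, cancel, ...), `d` the number of
parameters. -/
structure ChoiceModel (S A J O Z : Type*) [Fintype Z] (d : ℕ) where
  /-- The feature map `φ_j(s,a)`. -/
  feature : J → S × A → EuclideanSpace ℝ (Fin d)
  /-- The shock probabilities `P(z | o; θ)`. -/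
  shockProb : EuclideanSpace ℝ (Fin d) → O → Z → ℝ
  shockProb_mem : ∀ θ o, shockProb θ o ∈ stdSimplex ℝ Z
  /-- The orders whose shocks are imputed at `(s,a)` when the booking choice is `j`. -/
  orders : S × A → J → Finset O
  /-- The immediate reward `r^imm(s,a,j)`. -/
  immReward : S × A → J → ℝ
  /-- The shock reward `r^shock(o,z)`. -/
  shockReward : O → Z → ℝ
  /-- The next state `f(s,a,j,{z_o})`. -/
  nextState : S × A → J → (O → Z) → S

namespace ChoiceModel

variable {S A J O Z : Type*} [Fintype S] [DecidableEq S] [Fintype J] [Nonempty J]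
  [Fintype O] [DecidableEq O] [Fintype Z] {d : ℕ}

/-- The multinomial logit choice probabilities
`P(j | s,a; θ) = exp(θᵀφ_j(s,a)) / ∑_k exp(θᵀφ_k(s,a))`. -/
def choiceProb (C : ChoiceModel S A J O Z d) (θ : EuclideanSpace ℝ (Fin d))
    (x : S × A) (j : J) : ℝ :=
  Real.exp (inner ℝ θ (C.feature j x)) / ∑ k, Real.exp (inner ℝ θ (C.feature k x))

/-- The law of a synthetic draw at `(s,a)`: the booking choice `j'` is drawn from the logit
model and, independently, the shock outcome of every order from the shock model. -/
def drawProb (C : ChoiceModel S A J O Z d) (θ : EuclideanSpace ℝ (Fin d))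
    (x : S × A) (y : J × (O → Z)) : ℝ :=
  C.choiceProb θ x y.1 * ∏ o, C.shockProb θ o (y.2 o)

/-- The synthetic reward `r' = r^imm(s,a,j') + ∑_o r^shock(o,z_o)`. -/
def synthReward (C : ChoiceModel S A J O Z d) (x : S × A) (y : J × (O → Z)) : ℝ :=
  C.immReward x y.1 + ∑ o ∈ C.orders x y.1, C.shockReward o (y.2 o)

/-- The synthetic next state `s' = f(s,a,j',{z_o})`. -/
def synthNext (C : ChoiceModel S A J O Z d) (x : S × A) (y : J × (O → Z)) : S :=
  C.nextState x y.1 y.2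

theorem drawProb_nonneg (C : ChoiceModel S A J O Z d) (θ : EuclideanSpace ℝ (Fin d))
    (x : S × A) (y : J × (O → Z)) : 0 ≤ C.drawProb θ x y :=
  mul_nonneg (div_nonneg (Real.exp_pos _).le (Finset.sum_nonneg fun _ _ => (Real.exp_pos _).le))
    (Finset.prod_nonneg fun o _ => (C.shockProb_mem θ o).1 _)

theorem sum_drawProb (C : ChoiceModel S A J O Z d) (θ : EuclideanSpace ℝ (Fin d))
    (x : S × A) : ∑ y, C.drawProb θ x y = 1 := by
  have hz : ∑ z : O → Z, ∏ o, C.shockProb θ o (z o) = 1 := by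
    rw [← Fintype.prod_sum]
    exact Finset.prod_eq_one fun o _ => (C.shockProb_mem θ o).2
  have hj : ∑ j, C.choiceProb θ x j = 1 := by
    simp only [choiceProb]
    rw [← Finset.sum_div]
    exact div_self (Finset.sum_pos (fun _ _ => Real.exp_pos _) Finset.univ_nonempty).ne'
  rw [Fintype.sum_prod_type]
  simp only [drawProb]
  simp_rw [← Finset.mul_sum, hz, mul_one, hj]

/-- The approximate MDP induced by the choice model with fixed parameter `θ`: its reward is
the expected synthetic reward, its transition kernel the law of the synthetic next state. -/
def inducedMDP (C : ChoiceModel S A J O Z d) (θ : EuclideanSpace ℝ (Fin d))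
    (γ : ℝ) (hγ : γ ∈ Set.Ioo (0 : ℝ) 1) : MDP S A where
  reward x := ∑ y, C.drawProb θ x y * C.synthReward x y
  trans x s' := ∑ y, if C.synthNext x y = s' then C.drawProb θ x y else 0
  trans_mem x := by
    refine ⟨fun s' => Finset.sum_nonneg fun y _ => ?_, ?_⟩
    · split_ifs
      · exact C.drawProb_nonneg θ x y
      · exact le_rfl
    · rw [Finset.sum_comm]
      simp [C.sum_drawProb θ x]
  discount := γ
  discount_mem := hγ

/-- Tabular Q-learning with model-imputed sampling. At time `t` the pair `(s_t,a_t)` and the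
step size `α_t` are determined by the history `ℱ_t`; given `ℱ_t`, a synthetic draw `y_t` is made
from the choice model at `(s_t,a_t)`; it is known at time `t+1` and gives the synthetic reward
and next state with which the entry `(s_t,a_t)` of the table is updated. How `s_{t+1}` and
`a_{t+1}` arise from the history is left open: the trajectory may be that of the true
environment, or that of the model, under any (for example an ε-greedy) policy. -/
structure IsImputedQLearning [Fintype A] [Nonempty A] [DecidableEq A]
    {Ω : Type*} {mΩ : MeasurableSpace Ω} (C : ChoiceModel S A J O Z d)
    (θ : EuclideanSpace ℝ (Fin d)) (γ : ℝ) (μ : Measure Ω) (ℱ : Filtration ℕ mΩ)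
    (state : ℕ → Ω → S) (action : ℕ → Ω → A) (draw : ℕ → Ω → J × (O → Z))
    (α : ℕ → Ω → ℝ) (q₀ : S × A → ℝ) (Q : ℕ → Ω → S × A → ℝ) : Prop where
  state_meas : ∀ t s, MeasurableSet[ℱ t] {ω | state t ω = s}
  action_meas : ∀ t a, MeasurableSet[ℱ t] {ω | action t ω = a}
  draw_meas : ∀ t y, MeasurableSet[ℱ (t + 1)] {ω | draw t ω = y}
  step_meas : ∀ t, Measurable[ℱ t] (α t)
  step_mem : ∀ t ω, α t ω ∈ Set.Icc (0 : ℝ) 1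
  draw_law : ∀ t y,
    μ[{ω | draw t ω = y}.indicator (fun _ => (1 : ℝ)) | ℱ t] =ᵐ[μ]
      fun ω => C.drawProb θ (state t ω, action t ω) y
  table_zero : ∀ ω, Q 0 ω = q₀
  table_succ : ∀ t ω x, Q (t + 1) ω x =
    if x = (state t ω, action t ω) then
      (1 - α t ω) * Q t ω x +
        α t ω * (C.synthReward x (draw t ω) + γ * maxQ (Q t ω) (C.synthNext x (draw t ω)))
    else Q t ω x

end ChoiceModel

/-- Coverage: almost surely, along the visits to every state-action pair, the step sizes satisfy
the Robbins-Monro conditions `∑ α = ∞` and `∑ α² < ∞`. In particular every pair is visited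
infinitely often; conversely, if every pair is visited infinitely often, then the step sizes
`α_t = 1 / n_t(s_t,a_t)`, with `n_t` the number of visits up to and including time `t`, have this
property. -/
def RobbinsMonroCoverage {S A Ω : Type*} [DecidableEq S] [DecidableEq A]
    {mΩ : MeasurableSpace Ω} (μ : Measure Ω) (state : ℕ → Ω → S) (action : ℕ → Ω → A)
    (α : ℕ → Ω → ℝ) : Prop :=
  ∀ᵐ ω ∂μ, ∀ x : S × A,
    Tendsto (fun n => ∑ t ∈ Finset.range n, if (state t ω, action t ω) = x then α t ω else 0)
      atTop atTop ∧
    Summable fun t => if (state t ω, action t ω) = x then α t ω ^ 2 else 0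

end

/-!
Let `T` be the Bellman operator of the induced Markov decision process and `q` its fixed point.
Centring the sampled targets writes every entry of the table as a relaxation towards the
corresponding entry of `T (Q t)`, plus a noise term. The tables stay bounded, so the noise is a
martingale difference dominated by a multiple of the step size; since the squared step sizes are
summable, the noise series of each entry converges almost surely. From then on the argument is
pathwise. A convergent noise series is washed out by a relaxation whose step sizes have a divergent
sum, so if eventually `‖Q t - q‖ ≤ D`, then each entry eventually lies within `γ * D + ε` of its
limit. Hence the limit superior of `‖Q t - q‖` is at most `γ` times itself, that is, zero.

The bias of the limit is bounded by comparing the two Bellman operators at the fixed point of the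
true one, whose norm is at most `Rmax / (1 - γ)`.
-/

section Relaxation

variable {E : Type*} [NormedAddCommGroup E] [NormedSpace ℝ E]

lemma eventually_le_of_le_one_sub_mul {u a : ℕ → ℝ} {ε : ℝ} (ha : ∀ t, a t ≤ 1)
    (hsum : Tendsto (fun n => ∑ t ∈ Finset.range n, a t) atTop atTop)
    (hu : ∀ᶠ t in atTop, u (t + 1) ≤ (1 - a t) * u t) (hε : 0 < ε) :
    ∀ᶠ t in atTop, u t ≤ ε := by
  obtain ⟨N, hN⟩ := eventually_atTop.1 hu
  set s : ℕ → ℝ := fun n => ∑ t ∈ Finset.range n, a t with hs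
  set c : ℝ := max (u N) 0
  have hbound : ∀ n ≥ N, u n ≤ Real.exp (s N - s n) * c := by
    intro n hn
    induction n, hn using Nat.le_induction with
    | base => simp [c]
    | succ n hn ih =>
      calc u (n + 1) ≤ (1 - a n) * u n := hN n hn
        _ ≤ (1 - a n) * (Real.exp (s N - s n) * c) :=
          mul_le_mul_of_nonneg_left ih (sub_nonneg.2 (ha n))
        _ ≤ Real.exp (-a n) * (Real.exp (s N - s n) * c) := by
          gcongr
          exact Real.one_sub_le_exp_neg _
        _ = Real.exp (s N - s (n + 1)) * c := by
          rw [← mul_assoc, ← Real.exp_add, hs]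
          simp only [Finset.sum_range_succ]
          ring_nf
  have hlim : Tendsto (fun n => Real.exp (s N - s n) * c) atTop (𝓝 0) := by
    have hbot : Tendsto (fun n => s N - s n) atTop atBot :=
      tendsto_const_nhds.add_atBot (tendsto_neg_atTop_atBot.comp hsum)
    simpa using (Real.tendsto_exp_atBot.comp hbot).mul_const c
  filter_upwards [eventually_ge_atTop N, hlim.eventually_le_const hε] with n hn hle
  exact (hbound n hn).trans hle

lemma eventually_norm_le_of_relaxation {y g : ℕ → E} {a : ℕ → ℝ} {G ε : ℝ}
    (ha : ∀ t, a t ∈ Set.Icc (0 : ℝ) 1)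
    (hsum : Tendsto (fun n => ∑ t ∈ Finset.range n, a t) atTop atTop)
    (hy : ∀ t, y (t + 1) = (1 - a t) • y t + a t • g t)
    (hg : ∀ᶠ t in atTop, ‖g t‖ ≤ G) (hε : 0 < ε) : ∀ᶠ t in atTop, ‖y t‖ ≤ G + ε := by
  have hstep : ∀ᶠ t in atTop, ‖y (t + 1)‖ - G ≤ (1 - a t) * (‖y t‖ - G) := by
    filter_upwards [hg] with t ht
    have hmul : a t * ‖g t‖ ≤ a t * G := mul_le_mul_of_nonneg_left ht (ha t).1
    have hnorm : ‖y (t + 1)‖ ≤ (1 - a t) * ‖y t‖ + a t * ‖g t‖ := by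
      rw [hy]
      exact (norm_add_le _ _).trans_eq (by
        rw [norm_smul_of_nonneg (sub_nonneg.2 (ha t).2), norm_smul_of_nonneg (ha t).1])
    linarith
  filter_upwards [eventually_le_of_le_one_sub_mul (u := fun t => ‖y t‖ - G) (fun t => (ha t).2)
    hsum hstep hε] with t ht
  linarith

/-- Subtracting the convergent remainder `∑_{i<t} n i - l` from `y` turns the noise `n` into a
relaxation input that tends to zero. -/
lemma tendsto_zero_of_relaxation_of_tendsto_sum {y n : ℕ → E} {a : ℕ → ℝ} {l : E}
    (ha : ∀ t, a t ∈ Set.Icc (0 : ℝ) 1)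
    (hsum : Tendsto (fun n => ∑ t ∈ Finset.range n, a t) atTop atTop)
    (hy : ∀ t, y (t + 1) = (1 - a t) • y t + n t)
    (hn : Tendsto (fun m => ∑ t ∈ Finset.range m, n t) atTop (𝓝 l)) :
    Tendsto y atTop (𝓝 0) := by
  set r : ℕ → E := fun m => ∑ t ∈ Finset.range m, n t - l with hr
  have hr0 : Tendsto r atTop (𝓝 0) := by simpa using hn.sub_const l
  have hsub : ∀ t, y (t + 1) - r (t + 1) = (1 - a t) • (y t - r t) + a t • (-r t) := by
    intro t
    simp only [hy, hr, Finset.sum_range_succ]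
    module
  have hsub0 : Tendsto (fun t => y t - r t) atTop (𝓝 0) := by
    refine NormedAddGroup.tendsto_nhds_zero.2 fun ε hε => ?_
    have hsmall : ∀ᶠ t in atTop, ‖-r t‖ ≤ ε / 3 := by
      filter_upwards [NormedAddGroup.tendsto_nhds_zero.1 hr0 (ε / 3) (by positivity)] with t ht
      rw [norm_neg]
      exact ht.le
    filter_upwards [eventually_norm_le_of_relaxation (y := fun t => y t - r t) ha hsum hsub hsmall
      (show 0 < ε / 3 by positivity)] with t ht
    linarith
  simpa using hsub0.add hr0

lemma eventually_norm_le_of_noisy_relaxation {y g n : ℕ → E} {a : ℕ → ℝ} {l : E} {G ε : ℝ}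
    (ha : ∀ t, a t ∈ Set.Icc (0 : ℝ) 1)
    (hsum : Tendsto (fun n => ∑ t ∈ Finset.range n, a t) atTop atTop)
    (hn : Tendsto (fun m => ∑ t ∈ Finset.range m, n t) atTop (𝓝 l))
    (hy : ∀ t, y (t + 1) = (1 - a t) • y t + a t • g t + n t)
    (hg : ∀ᶠ t in atTop, ‖g t‖ ≤ G) (hε : 0 < ε) : ∀ᶠ t in atTop, ‖y t‖ ≤ G + ε := by
  obtain ⟨w, hw⟩ : ∃ w : ℕ → E, ∀ t, w (t + 1) = (1 - a t) • w t + n t :=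
    ⟨fun t => Nat.rec 0 (fun t v => (1 - a t) • v + n t) t, fun _ => rfl⟩
  have hw0 : Tendsto w atTop (𝓝 0) := tendsto_zero_of_relaxation_of_tendsto_sum ha hsum hw hn
  have hsub : ∀ t, y (t + 1) - w (t + 1) = (1 - a t) • (y t - w t) + a t • g t := by
    intro t
    rw [hy, hw]
    module
  filter_upwards [NormedAddGroup.tendsto_nhds_zero.1 hw0 _ (half_pos hε),
    eventually_norm_le_of_relaxation (y := fun t => y t - w t) ha hsum hsub hg (half_pos hε)]
    with t hwt hyt
  linarith [norm_le_norm_sub_add (y t) (w t)]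

lemma tendsto_zero_of_eventually_le_mul_add {β : Type*} {l : Filter β} [l.NeBot] {u : β → ℝ}
    {γ : ℝ} (hγ : γ < 1) (hu0 : ∀ x, 0 ≤ u x) (hu : l.IsBoundedUnder (· ≤ ·) u)
    (hstep : ∀ D ε, 0 < ε → (∀ᶠ x in l, u x ≤ D) → ∀ᶠ x in l, u x ≤ γ * D + ε) :
    Tendsto u l (𝓝 0) := by
  have hcob : l.IsCoboundedUnder (· ≤ ·) u :=
    IsBoundedUnder.isCoboundedUnder_le (isBoundedUnder_of ⟨0, hu0⟩)
  have hlimsup : limsup u l ≤ 0 := by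
    by_contra! hpos
    set ε := (1 - γ) * limsup u l / 4 with hε
    have hε0 : 0 < ε := by
      have := sub_pos.2 hγ
      positivity
    have hD : ∀ᶠ x in l, u x ≤ limsup u l + ε :=
      (eventually_lt_of_limsup_lt (lt_add_of_pos_right _ hε0) hu).mono fun _ => le_of_lt
    have hle : limsup u l ≤ γ * (limsup u l + ε) + ε := limsup_le_of_le hcob (hstep _ ε hε0 hD)
    nlinarith
  refine tendsto_order.2 ⟨fun b hb => Eventually.of_forall fun x => hb.trans_le (hu0 x),
    fun b hb => eventually_lt_of_limsup_lt (hlimsup.trans_lt hb) hu⟩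

theorem tendsto_of_async_contraction {ι : Type*} [Fintype ι] {T : (ι → E) → ι → E} {q : ι → E}
    {γ : ℝ} (hγ0 : 0 ≤ γ) (hγ1 : γ < 1) (hT : ∀ Q, ‖T Q - q‖ ≤ γ * ‖Q - q‖)
    {Q n : ℕ → ι → E} {a : ℕ → ι → ℝ} (ha : ∀ t i, a t i ∈ Set.Icc (0 : ℝ) 1)
    (hsum : ∀ i, Tendsto (fun m => ∑ t ∈ Finset.range m, a t i) atTop atTop)
    (hn : ∀ i, ∃ l, Tendsto (fun m => ∑ t ∈ Finset.range m, n t i) atTop (𝓝 l))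
    (hQ : ∀ t i, Q (t + 1) i = (1 - a t i) • Q t i + a t i • T (Q t) i + n t i)
    (hbdd : atTop.IsBoundedUnder (· ≤ ·) fun t => ‖Q t‖) : Tendsto Q atTop (𝓝 q) := by
  refine tendsto_iff_norm_sub_tendsto_zero.2
    (tendsto_zero_of_eventually_le_mul_add hγ1 (fun _ => norm_nonneg _) ?_ fun D ε hε hD => ?_)
  · obtain ⟨B, hB⟩ := hbdd
    refine ⟨B + ‖q‖, eventually_map.2 ((eventually_map.1 hB).mono fun t ht => ?_)⟩
    exact (norm_sub_le _ _).trans (add_le_add_left ht _)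
  · have hcoord : ∀ i, ∀ᶠ t in atTop, ‖Q t i - q i‖ ≤ γ * D + ε := by
      intro i
      obtain ⟨l, hl⟩ := hn i
      refine eventually_norm_le_of_noisy_relaxation (y := fun t => Q t i - q i)
        (g := fun t => T (Q t) i - q i) (fun t => ha t i) (hsum i) hl (fun t => ?_) ?_ hε
      · simp only [hQ]
        module
      · filter_upwards [hD] with t ht
        calc ‖T (Q t) i - q i‖ ≤ ‖T (Q t) - q‖ := norm_le_pi_norm (T (Q t) - q) i
          _ ≤ γ * ‖Q t - q‖ := hT _
          _ ≤ γ * D := mul_le_mul_of_nonneg_left ht hγ0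
    filter_upwards [eventually_all.2 hcoord, hD] with t ht hDt
    have hD0 : 0 ≤ D := (norm_nonneg _).trans hDt
    exact (pi_norm_le_iff_of_nonneg (by positivity)).2 ht

end Relaxation

/-- A martingale difference sequence: the increments `ξ t`, known at time `t + 1`, of a martingale.
The indexing matches partial sums over `Finset.range n`, which are known at time `n`. -/
structure IsMartingaleDiff {Ω : Type*} {_mΩ : MeasurableSpace Ω} (ξ : ℕ → Ω → ℝ)
    (ℱ : Filtration ℕ _mΩ) (μ : Measure Ω) : Prop where
  stronglyMeasurable : ∀ t, StronglyMeasurable[ℱ (t + 1)] (ξ t)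
  integrable : ∀ t, Integrable (ξ t) μ
  condExp_eq_zero : ∀ t, μ[ξ t | ℱ t] =ᵐ[μ] 0

lemma sum_range_ite_partialSum_le {R : Type*} [AddCommMonoid R] [LinearOrder R]
    [IsOrderedAddMonoid R] {b : ℕ → R} (hb : ∀ t, 0 ≤ b t) {k : R} (hk : 0 ≤ k) (n : ℕ) :
    ∑ t ∈ Finset.range n, (if ∑ i ∈ Finset.range (t + 1), b i ≤ k then b t else 0) ≤ k := by
  induction n with
  | zero => simpa using hk
  | succ n ih =>
    by_cases h : ∑ i ∈ Finset.range (n + 1), b i ≤ k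
    · refine le_trans (Finset.sum_le_sum fun t _ => ?_) h
      split_ifs
      exacts [le_rfl, hb t]
    · rwa [Finset.sum_range_succ, if_neg h, add_zero]

namespace IsMartingaleDiff

variable {Ω : Type*} {mΩ : MeasurableSpace Ω} {μ : Measure Ω} {ℱ : Filtration ℕ mΩ}
  {ξ : ℕ → Ω → ℝ}

lemma indicator (hξ : IsMartingaleDiff ξ ℱ μ) {s : ℕ → Set Ω}
    (hs : ∀ t, MeasurableSet[ℱ t] (s t)) :
    IsMartingaleDiff (fun t => (s t).indicator (ξ t)) ℱ μ where
  stronglyMeasurable t := (hξ.stronglyMeasurable t).indicator (ℱ.mono t.le_succ _ (hs t))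
  integrable t := (hξ.integrable t).indicator (ℱ.le t _ (hs t))
  condExp_eq_zero t := by
    filter_upwards [condExp_indicator (hξ.integrable t) (hs t), hξ.condExp_eq_zero t]
      with ω hind hzero
    simp [hind, hzero]

variable [IsFiniteMeasure μ]

lemma martingale_sum (hξ : IsMartingaleDiff ξ ℱ μ) :
    Martingale (fun n => ∑ t ∈ Finset.range n, ξ t) ℱ μ := by
  refine martingale_of_condExp_sub_eq_zero_nat (fun n => ?_)
    (fun n => integrable_finsetSum' _ fun t _ => hξ.integrable t) fun n => ?_
  · exact Finset.stronglyMeasurable_sum _ fun t ht =>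
      (hξ.stronglyMeasurable t).mono (ℱ.mono (Finset.mem_range.1 ht))
  · rw [Finset.sum_range_succ, add_sub_cancel_left]
    exact hξ.condExp_eq_zero n

lemma integral_mul_eq_zero (hξ : IsMartingaleDiff ξ ℱ μ) {t : ℕ} {X : Ω → ℝ}
    (hX : StronglyMeasurable[ℱ t] X) (hXξ : Integrable (X * ξ t) μ) : ∫ ω, (X * ξ t) ω ∂μ = 0 := by
  rw [← integral_condExp (ℱ.le t)]
  refine integral_eq_zero_of_ae ?_
  filter_upwards [condExp_mul_of_stronglyMeasurable_left hX hXξ (hξ.integrable t),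
    hξ.condExp_eq_zero t] with ω hpull hzero
  simp [hpull, hzero]

lemma integral_sum_sq (hξ : IsMartingaleDiff ξ ℱ μ) (hL2 : ∀ t, MemLp (ξ t) 2 μ) (n : ℕ) :
    ∫ ω, (∑ t ∈ Finset.range n, ξ t) ω ^ 2 ∂μ = ∑ t ∈ Finset.range n, ∫ ω, ξ t ω ^ 2 ∂μ := by
  induction n with
  | zero => simp
  | succ n ih =>
    set X := ∑ t ∈ Finset.range n, ξ t with hX
    have hXL2 : MemLp X 2 μ := memLp_finsetSum' _ fun t _ => hL2 t
    have hXξ : Integrable (X * ξ n) μ := hXL2.integrable_mul (hL2 n)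
    have hXX : Integrable (fun ω => X ω ^ 2) μ := hXL2.integrable_sq
    have hcross : Integrable (fun ω => 2 * (X * ξ n) ω) μ := hXξ.const_mul 2
    have horth : ∫ ω, (X * ξ n) ω ∂μ = 0 :=
      hξ.integral_mul_eq_zero (hξ.martingale_sum.stronglyMeasurable n) hXξ
    calc ∫ ω, (∑ t ∈ Finset.range (n + 1), ξ t) ω ^ 2 ∂μ
        = ∫ ω, (X ω ^ 2 + 2 * (X * ξ n) ω) + ξ n ω ^ 2 ∂μ := by
          simp only [Finset.sum_range_succ, ← hX, Pi.add_apply, Pi.mul_apply, add_sq, mul_assoc]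
      _ = ∫ ω, X ω ^ 2 ∂μ + 2 * ∫ ω, (X * ξ n) ω ∂μ + ∫ ω, ξ n ω ^ 2 ∂μ := by
          rw [integral_add (f := fun ω => X ω ^ 2 + 2 * (X * ξ n) ω) (hXX.add hcross)
            (hL2 n).integrable_sq, integral_add hXX hcross, integral_const_mul]
      _ = ∑ t ∈ Finset.range (n + 1), ∫ ω, ξ t ω ^ 2 ∂μ := by
          rw [horth, ih, Finset.sum_range_succ, mul_zero, add_zero]

theorem ae_exists_tendsto_sum_of_sum_integral_sq_le (hξ : IsMartingaleDiff ξ ℱ μ)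
    (hL2 : ∀ t, MemLp (ξ t) 2 μ) {K : ℝ}
    (hK : ∀ n, ∑ t ∈ Finset.range n, ∫ ω, ξ t ω ^ 2 ∂μ ≤ K) :
    ∀ᵐ ω ∂μ, ∃ l, Tendsto (fun n => ∑ t ∈ Finset.range n, ξ t ω) atTop (𝓝 l) := by
  have hL1 : ∀ n, eLpNorm (∑ t ∈ Finset.range n, ξ t) 1 μ ≤ (μ.real Set.univ + K).toNNReal := by
    intro n
    set X := ∑ t ∈ Finset.range n, ξ t
    have hX : MemLp X 2 μ := memLp_finsetSum' _ fun t _ => hL2 t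
    rw [eLpNorm_one_eq_lintegral_enorm,
      ← ofReal_integral_norm_eq_lintegral_enorm (hX.integrable one_le_two)]
    refine ENNReal.ofReal_le_ofReal ?_
    calc ∫ ω, ‖X ω‖ ∂μ ≤ ∫ ω, 1 + X ω ^ 2 ∂μ := by
          refine integral_mono (hX.integrable one_le_two).norm
            ((integrable_const _).add hX.integrable_sq) fun ω => ?_
          rw [Real.norm_eq_abs]
          nlinarith [sq_abs (X ω), sq_nonneg (|X ω| - 1)]
      _ = μ.real Set.univ + ∑ t ∈ Finset.range n, ∫ ω, ξ t ω ^ 2 ∂μ := by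
          rw [integral_add (integrable_const _) hX.integrable_sq, hξ.integral_sum_sq hL2 n]
          simp
      _ ≤ μ.real Set.univ + K := by gcongr; exact hK n
  simpa only [Finset.sum_apply] using
    hξ.martingale_sum.submartingale.exists_ae_tendsto_of_bdd hL1

lemma ae_exists_tendsto_sum_of_sum_sq_le (hξ : IsMartingaleDiff ξ ℱ μ) {K : ℝ}
    (hK : ∀ᵐ ω ∂μ, ∀ n, ∑ t ∈ Finset.range n, ξ t ω ^ 2 ≤ K) :
    ∀ᵐ ω ∂μ, ∃ l, Tendsto (fun n => ∑ t ∈ Finset.range n, ξ t ω) atTop (𝓝 l) := by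
  have hL2 : ∀ t, MemLp (ξ t) 2 μ := by
    intro t
    refine .of_bound (hξ.integrable t).aestronglyMeasurable (√K) ?_
    filter_upwards [hK] with ω hω
    refine Real.abs_le_sqrt (le_trans ?_ (hω (t + 1)))
    exact Finset.single_le_sum (f := fun t => ξ t ω ^ 2) (fun _ _ => sq_nonneg _)
      (Finset.self_mem_range_succ t)
  refine hξ.ae_exists_tendsto_sum_of_sum_integral_sq_le hL2 (K := ∫ _, K ∂μ) fun n => ?_
  rw [← integral_finsetSum _ fun t _ => (hL2 t).integrable_sq]
  exact integral_mono_ae (integrable_finsetSum _ fun t _ => (hL2 t).integrable_sq)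
    (integrable_const K) (hK.mono fun ω hω => hω n)

/-- Localisation: stopping the increments once `∑ c²` exceeds `k` leaves a sequence of bounded
quadratic variation, and almost every path is unaffected for some `k`. -/
theorem ae_exists_tendsto_sum_of_summable_sq (hξ : IsMartingaleDiff ξ ℱ μ) {c : ℕ → Ω → ℝ}
    (hc : ∀ t, Measurable[ℱ t] (c t)) (hξc : ∀ t, ∀ᵐ ω ∂μ, |ξ t ω| ≤ c t ω)
    (hsq : ∀ᵐ ω ∂μ, Summable fun t => c t ω ^ 2) :
    ∀ᵐ ω ∂μ, ∃ l, Tendsto (fun n => ∑ t ∈ Finset.range n, ξ t ω) atTop (𝓝 l) := by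
  set V : ℕ → Ω → ℝ := fun t ω => ∑ i ∈ Finset.range (t + 1), c i ω ^ 2
  have hV : ∀ t, Measurable[ℱ t] (V t) := fun t => Finset.measurable_sum _ fun i hi =>
    ((hc i).mono (ℱ.mono (Finset.mem_range_succ_iff.1 hi)) le_rfl).pow_const 2
  have hstopped : ∀ k : ℕ, ∀ᵐ ω ∂μ, ∃ l, Tendsto
      (fun n => ∑ t ∈ Finset.range n, {ω | V t ω ≤ k}.indicator (ξ t) ω) atTop (𝓝 l) := by
    intro k
    refine (hξ.indicator fun t =>
      measurableSet_le (hV t) measurable_const).ae_exists_tendsto_sum_of_sum_sq_le (K := k) ?_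
    filter_upwards [ae_all_iff.2 hξc] with ω hω n
    refine le_trans (Finset.sum_le_sum fun t _ => ?_)
      (sum_range_ite_partialSum_le (fun t => sq_nonneg (c t ω)) k.cast_nonneg n)
    simp only [Set.indicator_apply, Set.mem_ofPred_eq, V]
    split_ifs
    · exact sq_le_sq' (neg_le_of_abs_le (hω t)) (le_of_abs_le (hω t))
    · simp
  filter_upwards [ae_all_iff.2 hstopped, hsq] with ω hω hsum
  obtain ⟨k, hk⟩ := exists_nat_ge (∑' t, c t ω ^ 2)
  have hmem : ∀ t, ω ∈ {ω | V t ω ≤ k} := fun t =>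
    (hsum.sum_le_tsum _ fun _ _ => sq_nonneg _).trans hk
  simpa only [Set.indicator_of_mem (hmem _)] using hω k

end IsMartingaleDiff

theorem ae_tendsto_of_async_stochasticApproximation {ι Ω : Type*} [Fintype ι]
    {mΩ : MeasurableSpace Ω} {μ : Measure Ω} [IsFiniteMeasure μ] {ℱ : Filtration ℕ mΩ}
    {T : (ι → ℝ) → ι → ℝ} {q : ι → ℝ} {γ K : ℝ} (hγ0 : 0 ≤ γ) (hγ1 : γ < 1)
    (hT : ∀ Q, ‖T Q - q‖ ≤ γ * ‖Q - q‖) {Q a ξ : ℕ → Ω → ι → ℝ}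
    (ha_meas : ∀ t i, Measurable[ℱ t] fun ω => a t ω i)
    (ha : ∀ t ω i, a t ω i ∈ Set.Icc (0 : ℝ) 1)
    (hsum : ∀ᵐ ω ∂μ, ∀ i, Tendsto (fun n => ∑ t ∈ Finset.range n, a t ω i) atTop atTop)
    (hsq : ∀ᵐ ω ∂μ, ∀ i, Summable fun t => a t ω i ^ 2)
    (hξ : ∀ i, IsMartingaleDiff (fun t ω => ξ t ω i) ℱ μ)
    (hξa : ∀ t ω i, |ξ t ω i| ≤ K * a t ω i)
    (hQ : ∀ t ω i, Q (t + 1) ω i = (1 - a t ω i) * Q t ω i + a t ω i * T (Q t ω) i + ξ t ω i)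
    (hbdd : ∀ᵐ ω ∂μ, atTop.IsBoundedUnder (· ≤ ·) fun t => ‖Q t ω‖) :
    ∀ᵐ ω ∂μ, Tendsto (Q · ω) atTop (𝓝 q) := by
  have hnoise : ∀ i, ∀ᵐ ω ∂μ, ∃ l,
      Tendsto (fun n => ∑ t ∈ Finset.range n, ξ t ω i) atTop (𝓝 l) := by
    intro i
    refine (hξ i).ae_exists_tendsto_sum_of_summable_sq (fun t => (ha_meas t i).const_mul K)
      (fun t => ae_of_all _ fun ω => hξa t ω i) ?_
    filter_upwards [hsq] with ω hω
    simpa only [mul_pow] using (hω i).mul_left (K ^ 2)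
  filter_upwards [hsum, ae_all_iff.2 hnoise, hbdd] with ω hsumω hnoiseω hbddω
  exact tendsto_of_async_contraction hγ0 hγ1 hT (ha · ω) hsumω hnoiseω (hQ · ω) hbddω

lemma measurable_apply_of_countable {Ω Y β : Type*} [Countable Y] {m : MeasurableSpace Ω}
    [MeasurableSpace β] {f : Ω → Y} {g : Y → Ω → β} (hf : ∀ y, MeasurableSet {ω | f ω = y})
    (hg : ∀ y, Measurable (g y)) : Measurable fun ω => g (f ω) ω := by
  let _ : MeasurableSpace Y := ⊤
  have hgY : Measurable fun p : Ω × Y => g p.2 p.1 := measurable_from_prod_countable_left hg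
  exact hgY.comp (measurable_id.prodMk (measurable_to_countable' hf))

lemma condExp_apply_of_fintype {Ω Y : Type*} [Fintype Y] {m mΩ : MeasurableSpace Ω}
    {μ : Measure Ω} [IsFiniteMeasure μ] {f : Ω → Y} {p g : Y → Ω → ℝ}
    (hf : ∀ y, MeasurableSet {ω | f ω = y})
    (hp : ∀ y, μ[{ω | f ω = y}.indicator (fun _ => (1 : ℝ)) | m] =ᵐ[μ] p y)
    (hg : ∀ y, StronglyMeasurable[m] (g y)) (hgi : ∀ y, Integrable (g y) μ) :
    μ[fun ω => g (f ω) ω | m] =ᵐ[μ] fun ω => ∑ y, p y ω * g y ω := by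
  classical
  set χ : Y → Ω → ℝ := fun y => {ω | f ω = y}.indicator fun _ => 1
  have hχ : ∀ y, Integrable (χ y) μ := fun y => (integrable_const 1).indicator (hf y)
  have hχg : ∀ y, Integrable (χ y * g y) μ := by
    intro y
    have h : χ y * g y = {ω | f ω = y}.indicator (g y) := by
      ext ω
      simp [χ, Set.indicator_apply]
    exact h ▸ (hgi y).indicator (hf y)
  have hsum : (fun ω => g (f ω) ω) = ∑ y, χ y * g y := by
    ext ω
    simp [χ, Set.indicator_apply]
  rw [hsum]
  have hpull : ∀ y, μ[χ y * g y | m] =ᵐ[μ] μ[χ y | m] * g y := fun y =>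
    condExp_mul_of_stronglyMeasurable_right (hg y) (hχg y) (hχ y)
  filter_upwards [condExp_finsetSum (fun y _ => hχg y) m, ae_all_iff.2 hpull, ae_all_iff.2 hp]
    with ω hlin hpullω hpω
  rw [hlin, Finset.sum_apply]
  refine Finset.sum_congr rfl fun y _ => ?_
  rw [hpullω y, Pi.mul_apply, hpω y]

lemma maxQ_zero {S A : Type*} [Fintype A] [Nonempty A] (s : S) :
    maxQ (0 : S × A → ℝ) s = 0 :=
  Finset.sup'_const _ _

lemma abs_maxQ_le {S A : Type*} [Fintype S] [Fintype A] [Nonempty A] (Q : S × A → ℝ) (s : S) :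
    |maxQ Q s| ≤ ‖Q‖ := by
  simpa only [maxQ_zero, sub_zero, dist_zero_right] using abs_maxQ_sub_le Q 0 s

lemma measurable_maxQ {S A : Type*} [Fintype A] [Nonempty A] (s : S) :
    Measurable fun Q : S × A → ℝ => maxQ Q s := by
  simp only [maxQ]
  fun_prop

namespace MDP

variable {S A : Type*} [Fintype S]

/-- The transition error `ε_P`: the largest `ℓ¹`-distance between the transition laws of two Markov
decision processes at a common state-action pair. The distance is not halved, so it is twice the
total variation distance. -/
noncomputable def transDist (N M : MDP S A) : ℝ :=
  ⨆ x, ∑ s', |N.trans x s' - M.trans x s'|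

lemma transDist_nonneg (N M : MDP S A) : 0 ≤ N.transDist M :=
  Real.iSup_nonneg fun _ => Finset.sum_nonneg fun _ _ => abs_nonneg _

lemma sum_abs_trans_sub_le [Finite A] (N M : MDP S A) (x : S × A) :
    ∑ s', |N.trans x s' - M.trans x s'| ≤ N.transDist M :=
  le_ciSup (f := fun x => ∑ s', |N.trans x s' - M.trans x s'|) (Set.finite_range _).bddAbove x

variable [Fintype A] [Nonempty A]

lemma bellman_zero (M : MDP S A) : M.bellman 0 = M.reward := by
  ext x
  simp [bellman, maxQ_zero]

lemma bellman_qStar (M : MDP S A) : M.bellman M.qStar = M.qStar :=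
  M.contracting_bellman.fixedPoint_isFixedPt

lemma norm_bellman_sub_bellman_le_mul (M : MDP S A) (Q Q' : S × A → ℝ) :
    ‖M.bellman Q - M.bellman Q'‖ ≤ M.discount * ‖Q - Q'‖ := by
  rw [← dist_eq_norm, ← dist_eq_norm]
  exact M.contracting_bellman.toLipschitzWith.dist_le_mul Q Q'

lemma norm_bellman_sub_qStar_le (M : MDP S A) (Q : S × A → ℝ) :
    ‖M.bellman Q - M.qStar‖ ≤ M.discount * ‖Q - M.qStar‖ := by
  simpa only [bellman_qStar] using M.norm_bellman_sub_bellman_le_mul Q M.qStar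

lemma norm_bellman_le (M : MDP S A) (Q : S × A → ℝ) :
    ‖M.bellman Q‖ ≤ ‖M.reward‖ + M.discount * ‖Q‖ := by
  have hlip : ‖M.bellman Q - M.reward‖ ≤ M.discount * ‖Q‖ := by
    simpa only [bellman_zero, sub_zero] using M.norm_bellman_sub_bellman_le_mul Q 0
  linarith [norm_le_norm_add_norm_sub' (M.bellman Q) M.reward]

lemma norm_sub_qStar_le (M : MDP S A) (Q : S × A → ℝ) :
    ‖Q - M.qStar‖ ≤ ‖Q - M.bellman Q‖ / (1 - M.discount) := by
  rw [← dist_eq_norm, ← dist_eq_norm]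
  exact M.contracting_bellman.dist_le_of_fixedPoint Q M.bellman_qStar

lemma norm_qStar_le (M : MDP S A) : ‖M.qStar‖ ≤ ‖M.reward‖ / (1 - M.discount) := by
  simpa only [zero_sub, norm_neg, bellman_zero] using M.norm_sub_qStar_le 0

lemma norm_bellman_sub_bellman_le (N M : MDP S A) (hd : N.discount = M.discount)
    (Q : S × A → ℝ) :
    ‖N.bellman Q - M.bellman Q‖ ≤
      ‖N.reward - M.reward‖ + M.discount * (N.transDist M * ‖Q‖) := by
  have hγ0 : 0 ≤ M.discount := M.discount_mem.1.le
  have hP0 := N.transDist_nonneg M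
  refine (pi_norm_le_iff_of_nonneg (by positivity)).2 fun x => ?_
  have hsplit : (N.bellman Q - M.bellman Q) x = (N.reward - M.reward) x +
      M.discount * ∑ s', (N.trans x s' - M.trans x s') * maxQ Q s' := by
    simp only [bellman, hd, sub_mul, Finset.sum_sub_distrib, Pi.sub_apply]
    ring
  have htrans : |∑ s', (N.trans x s' - M.trans x s') * maxQ Q s'| ≤ N.transDist M * ‖Q‖ := by
    calc |∑ s', (N.trans x s' - M.trans x s') * maxQ Q s'|
        ≤ ∑ s', |N.trans x s' - M.trans x s'| * |maxQ Q s'| := by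
          simpa only [abs_mul] using Finset.abs_sum_le_sum_abs
            (fun s' => (N.trans x s' - M.trans x s') * maxQ Q s') Finset.univ
      _ ≤ ∑ s', |N.trans x s' - M.trans x s'| * ‖Q‖ := by
          gcongr
          exact abs_maxQ_le Q _
      _ ≤ N.transDist M * ‖Q‖ := by
          rw [← Finset.sum_mul]
          gcongr
          exact N.sum_abs_trans_sub_le M x
  rw [hsplit]
  refine (norm_add_le _ _).trans (add_le_add (norm_le_pi_norm (N.reward - M.reward) x) ?_)
  rw [Real.norm_eq_abs, abs_mul, abs_of_nonneg hγ0]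
  gcongr

/-- The simulation lemma. Since `M.qStar` is a fixed point of `M.bellman`, its distance to `N.qStar`
is controlled by how far `N.bellman` moves it. -/
theorem norm_qStar_sub_qStar_le (N M : MDP S A) (hd : N.discount = M.discount) :
    ‖N.qStar - M.qStar‖ ≤ ‖N.reward - M.reward‖ / (1 - M.discount) +
      M.discount * ‖M.reward‖ * N.transDist M / (1 - M.discount) ^ 2 := by
  have hγ0 : 0 ≤ M.discount := M.discount_mem.1.le
  have hγ1 : 0 < 1 - M.discount := sub_pos.2 M.discount_mem.2
  have hP0 := N.transDist_nonneg M
  calc ‖N.qStar - M.qStar‖ ≤ ‖N.bellman M.qStar - M.bellman M.qStar‖ / (1 - M.discount) := by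
        simpa only [norm_sub_rev, bellman_qStar, hd] using N.norm_sub_qStar_le M.qStar
    _ ≤ (‖N.reward - M.reward‖ + M.discount * (N.transDist M *
          (‖M.reward‖ / (1 - M.discount)))) / (1 - M.discount) := by
        gcongr
        refine (N.norm_bellman_sub_bellman_le M hd M.qStar).trans ?_
        gcongr
        exact M.norm_qStar_le
    _ = _ := by
        field_simp

end MDP

/-- The step size by which the update at time `t` acts on the table entry `x`: `α t` if the pair
visited at time `t` is `x`, and `0` otherwise. With it the asynchronous update of one entry becomes
a simultaneous update of all of them. -/
def visitStep {S A Ω : Type*} [DecidableEq S] [DecidableEq A] (state : ℕ → Ω → S)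
    (action : ℕ → Ω → A) (α : ℕ → Ω → ℝ) (t : ℕ) (ω : Ω) (x : S × A) : ℝ :=
  if (state t ω, action t ω) = x then α t ω else 0

namespace ChoiceModel

variable {S A J O Z : Type*} [Fintype Z] {d : ℕ}

lemma exists_abs_synthReward_le [Finite S] [Finite A] [Finite J] [Finite O]
    (C : ChoiceModel S A J O Z d) : ∃ R, ∀ x y, |C.synthReward x y| ≤ R := by
  obtain ⟨R, hR⟩ := Finite.exists_le fun p : (S × A) × J × (O → Z) => |C.synthReward p.1 p.2|
  exact ⟨R, fun x y => hR (x, y)⟩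

variable [Fintype A] [Nonempty A]

/-- The sampled Bellman target `r' + γ max_{a'} Q(s',a')` of the synthetic draw `y` at `x`. -/
def sampleTarget (C : ChoiceModel S A J O Z d) (γ : ℝ) (Q : S × A → ℝ) (x : S × A)
    (y : J × (O → Z)) : ℝ :=
  C.synthReward x y + γ * maxQ Q (C.synthNext x y)

lemma measurable_sampleTarget (C : ChoiceModel S A J O Z d) (γ : ℝ) (x : S × A)
    (y : J × (O → Z)) : Measurable fun Q => C.sampleTarget γ Q x y :=
  ((measurable_maxQ _).const_mul γ).const_add _

lemma abs_sampleTarget_le [Fintype S] (C : ChoiceModel S A J O Z d) {γ : ℝ} (hγ : 0 ≤ γ)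
    (Q : S × A → ℝ) (x : S × A) (y : J × (O → Z)) :
    |C.sampleTarget γ Q x y| ≤ |C.synthReward x y| + γ * ‖Q‖ := by
  refine (abs_add_le _ _).trans ?_
  rw [abs_mul, abs_of_nonneg hγ]
  gcongr
  exact abs_maxQ_le Q _

section InducedMDP

variable [Fintype S] [DecidableEq S] [Fintype J] [Nonempty J] [Fintype O] [DecidableEq O]

lemma bellman_inducedMDP (C : ChoiceModel S A J O Z d) (θ : EuclideanSpace ℝ (Fin d)) {γ : ℝ}
    (hγ : γ ∈ Set.Ioo (0 : ℝ) 1) (Q : S × A → ℝ) (x : S × A) :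
    (C.inducedMDP θ γ hγ).bellman Q x = ∑ y, C.drawProb θ x y * C.sampleTarget γ Q x y := by
  have hnext : ∑ s', (∑ y, if C.synthNext x y = s' then C.drawProb θ x y else 0) * maxQ Q s' =
      ∑ y, C.drawProb θ x y * maxQ Q (C.synthNext x y) := by
    simp_rw [Finset.sum_mul]
    rw [Finset.sum_comm]
    simp [ite_mul]
  simp only [MDP.bellman, inducedMDP, sampleTarget, hnext, mul_add, Finset.sum_add_distrib,
    Finset.mul_sum, mul_left_comm]

lemma sum_drawProb_mul_sampleTarget_sub_bellman (C : ChoiceModel S A J O Z d)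
    (θ : EuclideanSpace ℝ (Fin d)) {γ : ℝ} (hγ : γ ∈ Set.Ioo (0 : ℝ) 1) (Q : S × A → ℝ)
    (x : S × A) :
    ∑ y, C.drawProb θ x y * (C.sampleTarget γ Q x y - (C.inducedMDP θ γ hγ).bellman Q x) = 0 := by
  simp only [mul_sub, Finset.sum_sub_distrib]
  rw [← Finset.sum_mul, C.sum_drawProb, one_mul, C.bellman_inducedMDP, sub_self]

lemma exists_abs_sampleTarget_sub_bellman_le (C : ChoiceModel S A J O Z d)
    (θ : EuclideanSpace ℝ (Fin d)) {γ : ℝ} (hγ : γ ∈ Set.Ioo (0 : ℝ) 1) (B : ℝ) :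
    ∃ K, ∀ Q : S × A → ℝ, ‖Q‖ ≤ B → ∀ x y,
      |C.sampleTarget γ Q x y - (C.inducedMDP θ γ hγ).bellman Q x| ≤ K := by
  obtain ⟨R, hR⟩ := C.exists_abs_synthReward_le
  set N := C.inducedMDP θ γ hγ
  refine ⟨R + γ * B + (‖N.reward‖ + γ * B), fun Q hQ x y => ?_⟩
  have hγQ : γ * ‖Q‖ ≤ γ * B := mul_le_mul_of_nonneg_left hQ hγ.1.le
  have hN : |N.bellman Q x| ≤ ‖N.reward‖ + γ * ‖Q‖ :=
    (norm_le_pi_norm (N.bellman Q) x).trans (N.norm_bellman_le Q)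
  linarith [abs_sub (C.sampleTarget γ Q x y) (N.bellman Q x),
    C.abs_sampleTarget_le hγ.1.le Q x y, hR x y]

/-- The contribution of the draw `y` at time `t` to the table entry `x`, centred at its conditional
expectation: the deviation of the sampled target from the Bellman operator of the induced Markov
decision process, weighted by `visitStep`. -/
noncomputable def samplingNoise [DecidableEq A] {Ω : Type*} (C : ChoiceModel S A J O Z d)
    (θ : EuclideanSpace ℝ (Fin d)) {γ : ℝ} (hγ : γ ∈ Set.Ioo (0 : ℝ) 1) (state : ℕ → Ω → S)
    (action : ℕ → Ω → A) (α : ℕ → Ω → ℝ) (Q : ℕ → Ω → S × A → ℝ) (t : ℕ) (x : S × A)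
    (y : J × (O → Z)) (ω : Ω) : ℝ :=
  visitStep state action α t ω x *
    (C.sampleTarget γ (Q t ω) x y - (C.inducedMDP θ γ hγ).bellman (Q t ω) x)

lemma sum_drawProb_mul_samplingNoise [DecidableEq A] {Ω : Type*} (C : ChoiceModel S A J O Z d)
    (θ : EuclideanSpace ℝ (Fin d)) {γ : ℝ} (hγ : γ ∈ Set.Ioo (0 : ℝ) 1) (state : ℕ → Ω → S)
    (action : ℕ → Ω → A) (α : ℕ → Ω → ℝ) (Q : ℕ → Ω → S × A → ℝ) (t : ℕ) (x : S × A) (ω : Ω) :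
    ∑ y, C.drawProb θ (state t ω, action t ω) y *
      C.samplingNoise θ hγ state action α Q t x y ω = 0 := by
  by_cases hvisit : (state t ω, action t ω) = x
  · simp only [samplingNoise, mul_left_comm _ (visitStep state action α t ω x), ← Finset.mul_sum,
      hvisit, C.sum_drawProb_mul_sampleTarget_sub_bellman, mul_zero]
  · simp only [samplingNoise, visitStep, if_neg hvisit, zero_mul, mul_zero, Finset.sum_const_zero]

end InducedMDP

namespace IsImputedQLearning

variable [DecidableEq S] [DecidableEq A] [Fintype J] [Fintype O] {Ω : Type*}
  {mΩ : MeasurableSpace Ω} {C : ChoiceModel S A J O Z d} {θ : EuclideanSpace ℝ (Fin d)} {γ : ℝ}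
  {μ : Measure Ω} {ℱ : Filtration ℕ mΩ} {state : ℕ → Ω → S} {action : ℕ → Ω → A}
  {draw : ℕ → Ω → J × (O → Z)} {α : ℕ → Ω → ℝ} {q₀ : S × A → ℝ} {Q : ℕ → Ω → S × A → ℝ}

lemma visitStep_mem (hQ : C.IsImputedQLearning θ γ μ ℱ state action draw α q₀ Q) (t : ℕ) (ω : Ω)
    (x : S × A) : visitStep state action α t ω x ∈ Set.Icc (0 : ℝ) 1 := by
  unfold visitStep
  split_ifs
  exacts [hQ.step_mem t ω, ⟨le_rfl, zero_le_one⟩]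

lemma measurable_visitStep (hQ : C.IsImputedQLearning θ γ μ ℱ state action draw α q₀ Q) (t : ℕ)
    (x : S × A) : Measurable[ℱ t] fun ω => visitStep state action α t ω x := by
  have hvisit : MeasurableSet[ℱ t] {ω | (state t ω, action t ω) = x} := by
    simpa only [Prod.ext_iff, Set.ofPred_and] using
      (hQ.state_meas t x.1).inter (hQ.action_meas t x.2)
  exact Measurable.ite hvisit (hQ.step_meas t) measurable_const

lemma table_succ_eq (hQ : C.IsImputedQLearning θ γ μ ℱ state action draw α q₀ Q) (t : ℕ) (ω : Ω)
    (x : S × A) :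
    Q (t + 1) ω x = (1 - visitStep state action α t ω x) * Q t ω x +
      visitStep state action α t ω x * C.sampleTarget γ (Q t ω) x (draw t ω) := by
  rw [hQ.table_succ, visitStep, sampleTarget]
  simp only [eq_comm (a := x)]
  split_ifs <;> ring

lemma measurable_table (hQ : C.IsImputedQLearning θ γ μ ℱ state action draw α q₀ Q) (t : ℕ) :
    Measurable[ℱ t] (Q t) := by
  induction t with
  | zero =>
    rw [funext hQ.table_zero]
    exact measurable_const
  | succ t ih =>
    have hle : ℱ t ≤ ℱ (t + 1) := ℱ.mono t.le_succ
    have hQt : Measurable[ℱ (t + 1)] (Q t) := ih.mono hle le_rfl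
    refine (@measurable_pi_iff _ _ _ (ℱ (t + 1)) _ _).2 fun x => ?_
    have hstep : Measurable[ℱ (t + 1)] fun ω => visitStep state action α t ω x :=
      (hQ.measurable_visitStep t x).mono hle le_rfl
    have htarget : Measurable[ℱ (t + 1)] fun ω => C.sampleTarget γ (Q t ω) x (draw t ω) :=
      measurable_apply_of_countable (g := fun y ω => C.sampleTarget γ (Q t ω) x y)
        (hQ.draw_meas t) fun y => (C.measurable_sampleTarget γ x y).comp hQt
    simp only [hQ.table_succ_eq]
    exact ((hstep.const_sub 1).mul ((measurable_pi_apply x).comp hQt)).add (hstep.mul htarget)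

variable [Fintype S]

lemma norm_table_le (hQ : C.IsImputedQLearning θ γ μ ℱ state action draw α q₀ Q) (hγ : 0 ≤ γ)
    {B : ℝ} (hq₀ : ‖q₀‖ ≤ B) (hB : ∀ x y, |C.synthReward x y| + γ * B ≤ B) (t : ℕ) (ω : Ω) :
    ‖Q t ω‖ ≤ B := by
  induction t with
  | zero => rwa [hQ.table_zero]
  | succ t ih =>
    refine (pi_norm_le_iff_of_nonneg ((norm_nonneg q₀).trans hq₀)).2 fun x => ?_
    have hold : Q t ω x ∈ Set.Icc (-B) B := abs_le.1 ((norm_le_pi_norm (Q t ω) x).trans ih)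
    have htarget : C.sampleTarget γ (Q t ω) x (draw t ω) ∈ Set.Icc (-B) B := by
      refine abs_le.1 ((C.abs_sampleTarget_le hγ _ _ _).trans (le_trans ?_ (hB x (draw t ω))))
      gcongr
    obtain ⟨hstep0, hstep1⟩ := hQ.visitStep_mem t ω x
    rw [Real.norm_eq_abs, hQ.table_succ_eq]
    exact abs_le.2 (convex_Icc (-B) B hold htarget (sub_nonneg.2 hstep1) hstep0
      (sub_add_cancel 1 _))

lemma exists_norm_table_le (hQ : C.IsImputedQLearning θ γ μ ℱ state action draw α q₀ Q)
    (hγ : γ ∈ Set.Ioo (0 : ℝ) 1) : ∃ B, ∀ t ω, ‖Q t ω‖ ≤ B := by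
  obtain ⟨R, hR⟩ := C.exists_abs_synthReward_le
  have hγ1 : 0 < 1 - γ := sub_pos.2 hγ.2
  refine ⟨max ‖q₀‖ (R / (1 - γ)), hQ.norm_table_le hγ.1.le (le_max_left _ _) fun x y => ?_⟩
  have hRB : R ≤ max ‖q₀‖ (R / (1 - γ)) * (1 - γ) := (div_le_iff₀ hγ1).1 (le_max_right _ _)
  linarith [hR x y]

variable [Nonempty J] [DecidableEq O]

lemma table_succ_eq_bellman_add_samplingNoise
    (hQ : C.IsImputedQLearning θ γ μ ℱ state action draw α q₀ Q) (hγ : γ ∈ Set.Ioo (0 : ℝ) 1)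
    (t : ℕ) (ω : Ω) (x : S × A) :
    Q (t + 1) ω x = (1 - visitStep state action α t ω x) * Q t ω x +
      visitStep state action α t ω x * (C.inducedMDP θ γ hγ).bellman (Q t ω) x +
      C.samplingNoise θ hγ state action α Q t x (draw t ω) ω := by
  rw [hQ.table_succ_eq, samplingNoise]
  ring

lemma exists_abs_samplingNoise_le (hQ : C.IsImputedQLearning θ γ μ ℱ state action draw α q₀ Q)
    (hγ : γ ∈ Set.Ioo (0 : ℝ) 1) :
    ∃ K, ∀ t x y ω, |C.samplingNoise θ hγ state action α Q t x y ω| ≤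
      K * visitStep state action α t ω x := by
  obtain ⟨B, hB⟩ := hQ.exists_norm_table_le hγ
  obtain ⟨K, hK⟩ := C.exists_abs_sampleTarget_sub_bellman_le θ hγ B
  refine ⟨K, fun t x y ω => ?_⟩
  have hstep0 := (hQ.visitStep_mem t ω x).1
  rw [samplingNoise, abs_mul, abs_of_nonneg hstep0, mul_comm]
  exact mul_le_mul_of_nonneg_right (hK _ (hB t ω) _ _) hstep0

lemma measurable_samplingNoise (hQ : C.IsImputedQLearning θ γ μ ℱ state action draw α q₀ Q)
    (hγ : γ ∈ Set.Ioo (0 : ℝ) 1) (t : ℕ) (x : S × A) (y : J × (O → Z)) :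
    Measurable[ℱ t] (C.samplingNoise θ hγ state action α Q t x y) := by
  have hbellman : Measurable fun q => (C.inducedMDP θ γ hγ).bellman q x :=
    (measurable_pi_apply x).comp
      (C.inducedMDP θ γ hγ).contracting_bellman.toLipschitzWith.continuous.measurable
  exact (hQ.measurable_visitStep t x).mul
    (((C.measurable_sampleTarget γ x y).sub hbellman).comp (hQ.measurable_table t))

theorem isMartingaleDiff_samplingNoise [IsFiniteMeasure μ]
    (hQ : C.IsImputedQLearning θ γ μ ℱ state action draw α q₀ Q) (hγ : γ ∈ Set.Ioo (0 : ℝ) 1)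
    (x : S × A) :
    IsMartingaleDiff (fun t ω => C.samplingNoise θ hγ state action α Q t x (draw t ω) ω) ℱ μ := by
  set ζ := C.samplingNoise θ hγ state action α Q
  have hζ : ∀ t y, Measurable[ℱ t] (ζ t x y) := (hQ.measurable_samplingNoise hγ · x ·)
  have hnoise : ∀ t, Measurable[ℱ (t + 1)] fun ω => ζ t x (draw t ω) ω := fun t =>
    measurable_apply_of_countable (hQ.draw_meas t) fun y => (hζ t y).mono (ℱ.mono t.le_succ) le_rfl
  obtain ⟨K, hK⟩ : ∃ K, ∀ t y ω, |ζ t x y ω| ≤ K := by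
    obtain ⟨K, hK⟩ := hQ.exists_abs_samplingNoise_le hγ
    refine ⟨|K|, fun t y ω => (hK t x y ω).trans ((le_abs_self _).trans ?_)⟩
    obtain ⟨hstep0, hstep1⟩ := hQ.visitStep_mem t ω x
    rw [abs_mul, abs_of_nonneg hstep0]
    exact mul_le_of_le_one_right (abs_nonneg K) hstep1
  refine ⟨fun t => (hnoise t).stronglyMeasurable, fun t => ?_, fun t => ?_⟩
  · exact .of_bound ((hnoise t).mono (ℱ.le _) le_rfl).aestronglyMeasurable K
      (ae_of_all μ fun ω => hK t _ ω)
  · filter_upwards [condExp_apply_of_fintype (g := ζ t x)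
      (fun y => ℱ.le (t + 1) _ (hQ.draw_meas t y)) (hQ.draw_law t)
      (fun y => (hζ t y).stronglyMeasurable)
      fun y => .of_bound ((hζ t y).mono (ℱ.le t) le_rfl).aestronglyMeasurable K
        (ae_of_all μ (hK t y))] with ω hω
    rw [hω, C.sum_drawProb_mul_samplingNoise, Pi.zero_apply]

theorem ae_tendsto_qStar [IsFiniteMeasure μ]
    (hQ : C.IsImputedQLearning θ γ μ ℱ state action draw α q₀ Q) (hγ : γ ∈ Set.Ioo (0 : ℝ) 1)
    (hcov : RobbinsMonroCoverage μ state action α) :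
    ∀ᵐ ω ∂μ, Tendsto (Q · ω) atTop (𝓝 (C.inducedMDP θ γ hγ).qStar) := by
  obtain ⟨B, hB⟩ := hQ.exists_norm_table_le hγ
  obtain ⟨K, hK⟩ := hQ.exists_abs_samplingNoise_le hγ
  refine ae_tendsto_of_async_stochasticApproximation hγ.1.le hγ.2
    (C.inducedMDP θ γ hγ).norm_bellman_sub_qStar_le hQ.measurable_visitStep hQ.visitStep_mem
    (hcov.mono fun ω hω x => (hω x).1) (hcov.mono fun ω hω x => ?_)
    (hQ.isMartingaleDiff_samplingNoise hγ) (fun t ω x => hK t x (draw t ω) ω)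
    (hQ.table_succ_eq_bellman_add_samplingNoise hγ)
    (ae_of_all μ fun ω => isBoundedUnder_of ⟨B, (hB · ω)⟩)
  simpa only [visitStep, ite_pow, zero_pow two_ne_zero] using (hω x).2

end IsImputedQLearning

end ChoiceModel

theorem mainTheorem3 {S A J O Z Ω : Type*} [Fintype S] [DecidableEq S]
    [Fintype A] [Nonempty A] [DecidableEq A] [Fintype J] [Nonempty J]
    [Fintype O] [DecidableEq O] [Fintype Z] {d : ℕ}
    {mΩ : MeasurableSpace Ω} (μ : Measure Ω) [IsProbabilityMeasure μ] (ℱ : Filtration ℕ mΩ)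
    -- the true MDP, with bounded rewards
    (M : MDP S A) (Rmax : ℝ) (hR : ∀ x, |M.reward x| ≤ Rmax)
    -- the fixed choice model and the approximate MDP that it induces
    (C : ChoiceModel S A J O Z d) (θ : EuclideanSpace ℝ (Fin d))
    (Mθ : MDP S A) (hMθ : Mθ = C.inducedMDP θ M.discount M.discount_mem)
    -- tabular Q-learning driven by samples of the approximate MDP
    (state : ℕ → Ω → S) (action : ℕ → Ω → A) (draw : ℕ → Ω → J × (O → Z))
    (α : ℕ → Ω → ℝ) (q₀ : S × A → ℝ) (Q : ℕ → Ω → S × A → ℝ)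
    (hQ : C.IsImputedQLearning θ M.discount μ ℱ state action draw α q₀ Q)
    (hcov : RobbinsMonroCoverage μ state action α)
    -- the reward and transition approximation errors
    (εr εP : ℝ) (hεr : εr = ‖Mθ.reward - M.reward‖)
    (hεP : εP = ⨆ x, ∑ s', |Mθ.trans x s' - M.trans x s'|) :
    ∀ᵐ ω ∂μ,
      Tendsto (fun t => ‖Q t ω - Mθ.qStar‖) atTop (𝓝 0) ∧
      Tendsto (fun t => ‖Q t ω - M.qStar‖) atTop (𝓝 ‖Mθ.qStar - M.qStar‖) ∧
      limsup (fun t => ‖Q t ω - M.qStar‖) atTop ≤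
        εr / (1 - M.discount) + M.discount * Rmax * εP / (1 - M.discount) ^ 2 := by
  subst hMθ hεr hεP
  filter_upwards [hQ.ae_tendsto_qStar M.discount_mem hcov] with ω hω
  set N := C.inducedMDP θ M.discount M.discount_mem
  have hlim : Tendsto (fun t => ‖Q t ω - M.qStar‖) atTop (𝓝 ‖N.qStar - M.qStar‖) :=
    (hω.sub_const _).norm
  refine ⟨tendsto_iff_norm_sub_tendsto_zero.1 hω, hlim, ?_⟩
  have hγ0 : 0 ≤ M.discount := M.discount_mem.1.le
  have hP0 : 0 ≤ N.transDist M := N.transDist_nonneg M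
  have : Nonempty (S × A) := ⟨(state 0 ω, action 0 ω)⟩
  have hreward : ‖M.reward‖ ≤ Rmax := (pi_norm_le_iff_of_nonempty _).2 hR
  calc limsup (fun t => ‖Q t ω - M.qStar‖) atTop = ‖N.qStar - M.qStar‖ := hlim.limsup_eq
    _ ≤ ‖N.reward - M.reward‖ / (1 - M.discount) +
        M.discount * ‖M.reward‖ * N.transDist M / (1 - M.discount) ^ 2 :=
      N.norm_qStar_sub_qStar_le M rfl
    _ ≤ ‖N.reward - M.reward‖ / (1 - M.discount) +
        M.discount * Rmax * N.transDist M / (1 - M.discount) ^ 2 := by gcongr
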